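/- For an integer $d\ge 1$ and an integer $m\ge 1$ let $F_d(m)$ be the number of even primitive Dirichlet characters of order $d$ and conductor $m$. Fix a real number $B>0$ and real numbers $\alpha_d,\beta_d$ for all $d$, and for $X\in\mathbb{R}$ or $X=\infty$ put $$\mathcal{E}_d(X):=\sum_{1\le m\le X}F_d(m)\left(B^2\,\frac{d\,m^{2\alpha_d}}{\varphi(m)\log(m)^{1-2\beta_d}}\right)^{\varphi(d)/4},$$ where $\varphi$ is Euler's function (the terms with $F_d(m)=0$, in particular $m=1$ for $d\geq 2$, are $0$). Proposition. Let $p$ be a prime, and put $\sigma:=(1-2\alpha_p)(p-1)/4$ and $\tau:=\beta_p(p-1)/2$. As $X\in\mathbb{R}$ goes to infinity, with implied constants that depend only on $p$, $B$, $\alpha_p$ and $\beta_p$: (i) if $\sigma>1$, or $\sigma=1$ and $\tau<-1$, then $\mathcal{E}_p(\infty)$ is finite; (ii) if $\sigma=1$ and $\tau=-1$, then $\mathcal{E}_p(X)\ll\log\log(X)$; (iii) if $\sigma=1$ and $\tau>-1$, then $\mathcal{E}_p(X)\ll\log(X)^{\tau+1}$; (iv) if $0<\sigma<1$, then $\mathcal{E}_p(X)\ll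 X^{1-\sigma}\log(X)^{\tau}$. -/

import Mathlib

open scoped ENNReal

noncomputable section

/-- `F_d(m)`: the number of even primitive Dirichlet characters of order `d` and conductor `m`
(a primitive character of conductor `m` is a character of level `m` whose conductor is `m`;
the order is the order in the group of characters of level `m`). -/
def numEvenPrimitive (d m : ℕ) : ℕ :=
  Nat.card {χ : DirichletCharacter ℂ m // χ.IsPrimitive ∧ χ.Even ∧ orderOf χ = d}

/-- The `m`-th summand
`F_d(m) * (B² * d * m^(2 α_d) / (φ(m) * log(m)^(1 - 2 β_d)))^(φ(d)/4)`. -/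
def expectationTerm (B : ℝ) (α β : ℕ → ℝ) (d m : ℕ) : ℝ :=
  (numEvenPrimitive d m : ℝ) *
    (B ^ 2 * ((d : ℝ) * (m : ℝ) ^ (2 * α d) /
      ((Nat.totient m : ℝ) * Real.log (m : ℝ) ^ (1 - 2 * β d)))) ^ ((Nat.totient d : ℝ) / 4)

/-- `ℰ_d(X)`: the sum of the terms over the integers `1 ≤ m ≤ X`, for real `X`. -/
def expectation (B : ℝ) (α β : ℕ → ℝ) (d : ℕ) (X : ℝ) : ℝ :=
  ∑ m ∈ Finset.Icc 1 ⌊X⌋₊, expectationTerm B α β d m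

/-- `ℰ_d(∞)`: the sum of the (nonnegative) terms over all integers `m ≥ 1`, in `[0, ∞]`. -/
def expectationInfty (B : ℝ) (α β : ℕ → ℝ) (d : ℕ) : ℝ≥0∞ :=
  ∑' m : ℕ+, ENNReal.ofReal (expectationTerm B α β d (m : ℕ))

end

/-! Dropping evenness and replacing "order `p`" by "`p`-th power trivial" bounds `F_p(m)` by a count
that is submultiplicative over coprime levels. At a prime `q ≠ p` that count is at most `p - 1` if
`q ≡ 1 mod p` and zero otherwise, it vanishes at higher powers of `q`, and it is bounded at powers
of `p`. The resulting multiplicative majorant `g = torsionMajorant p` therefore gives weight `p - 1`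
to a proportion `1 / (p - 1)` of the primes, so its mean value should be bounded: `∑_{m ≤ N} g(m) ≪
N` (`exists_sum_torsionMajorant_le`).

This is proved from upper bounds for Dirichlet `L`-functions near `s = 1`, which give `∑ g(m) m^(-s)
≪ 1 / (s - 1)`. Taking `s = 1 + 1 / log N` gives `∑ g(m) / m ≪ log N`, and Chebyshev's bound for `ψ`
turns this logarithmic mean into the ordinary one.

The crude bound `1 / φ(m) ≪ log m / m` cancels one logarithm in the denominator, so the `m`-th term
is `≪ g(m) m^(-σ) (log m)^τ`. The dyadic block at `2^k` then contributes `≪ 2^(k(1-σ)) k^τ`, and the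
four cases are the four behaviours of the sum of these over `k`. -/

/-! ### Counting primitive characters with trivial `p`-th power -/

/-- The number of primitive Dirichlet characters of level `m` whose `p`-th power is trivial. -/
noncomputable def numPrimitiveTorsion (p m : ℕ) : ℕ :=
  Nat.card {χ : DirichletCharacter ℂ m // χ.IsPrimitive ∧ χ ^ p = 1}

theorem numEvenPrimitive_le_numPrimitiveTorsion (p m : ℕ) [NeZero m] :
    numEvenPrimitive p m ≤ numPrimitiveTorsion p m := by
  refine Nat.card_le_card_of_injective
    (fun χ : {χ : DirichletCharacter ℂ m // χ.IsPrimitive ∧ χ.Even ∧ orderOf χ = p} ↦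
      (⟨χ.1, χ.2.1, orderOf_dvd_iff_pow_eq_one.1 χ.2.2.2.dvd⟩ :
        {χ : DirichletCharacter ℂ m // χ.IsPrimitive ∧ χ ^ p = 1})) ?_
  intro χ ψ h
  exact Subtype.ext (congrArg (fun x ↦ x.1) h)

/-- The unit group of `ZMod (a * b)` splits as a product for coprime `a` and `b`. -/
theorem exists_unitsEquiv_of_coprime {a b : ℕ} (h : a.Coprime b) :
    ∃ E : (ZMod (a * b))ˣ ≃* (ZMod a)ˣ × (ZMod b)ˣ, ∀ x,
      E x = (ZMod.unitsMap (Nat.dvd_mul_right a b) x, ZMod.unitsMap (Nat.dvd_mul_left b a) x) := by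
  refine ⟨(Units.mapEquiv (ZMod.chineseRemainder h).toMulEquiv).trans MulEquiv.prodUnits, ?_⟩
  intro x
  refine Prod.ext (Units.ext ?_) (Units.ext ?_)
  · exact RingHom.congr_fun (RingHom.ext_zmod ((RingHom.fst _ _).comp
      (ZMod.chineseRemainder h).toRingHom) (ZMod.castHom (Nat.dvd_mul_right a b) (ZMod a))) x
  · exact RingHom.congr_fun (RingHom.ext_zmod ((RingHom.snd _ _).comp
      (ZMod.chineseRemainder h).toRingHom) (ZMod.castHom (Nat.dvd_mul_left b a) (ZMod b))) x

/-- Factoring through level `d` means being trivial on the kernel of reduction mod `d`. This lemma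
and `isPrimitive_of_forall_le` turn primitivity into that group-theoretic form. -/
theorem DirichletCharacter.IsPrimitive.eq_of_ker_le {m d : ℕ} [NeZero m]
    {χ : DirichletCharacter ℂ m} (hχ : χ.IsPrimitive) (hd : d ∣ m)
    (h : (ZMod.unitsMap hd).ker ≤ χ.toUnitHom.ker) : m ≤ d := by
  have h1 := (DirichletCharacter.factorsThrough_iff_ker_unitsMap hd).2 h
  have h2 : χ.conductor ≤ d := Nat.sInf_le h1
  rwa [hχ] at h2

theorem isPrimitive_of_forall_le {m : ℕ} [NeZero m] {χ : DirichletCharacter ℂ m}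
    (h : ∀ d (hd : d ∣ m), (ZMod.unitsMap hd).ker ≤ χ.toUnitHom.ker → m ≤ d) : χ.IsPrimitive :=
  le_antisymm (Nat.le_of_dvd (NeZero.pos m) χ.conductor_dvd_level)
    (h _ χ.conductor_dvd_level ((DirichletCharacter.factorsThrough_iff_ker_unitsMap _).1
      χ.factorsThrough_conductor))

/-- A character is determined by its restrictions to the two Chinese remainder factors. If the
restriction to the factor `a` came from level `d ∣ a`, the whole character would come from level `d
* b`, so primitivity passes to both restrictions. -/
theorem numPrimitiveTorsion_mul_le (p : ℕ) {a b : ℕ} [NeZero a] [NeZero b] (h : a.Coprime b) :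
    numPrimitiveTorsion p (a * b) ≤ numPrimitiveTorsion p a * numPrimitiveTorsion p b := by
  obtain ⟨E, hE⟩ := exists_unitsEquiv_of_coprime h
  let ιa : (ZMod a)ˣ →* (ZMod (a * b))ˣ := E.symm.toMonoidHom.comp (MonoidHom.inl _ _)
  let ιb : (ZMod b)ˣ →* (ZMod (a * b))ˣ := E.symm.toMonoidHom.comp (MonoidHom.inr _ _)
  have hι (x : (ZMod (a * b))ˣ) : x = ιa (ZMod.unitsMap (Nat.dvd_mul_right a b) x) *
      ιb (ZMod.unitsMap (Nat.dvd_mul_left b a) x) := by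
    apply E.injective
    rw [map_mul]
    simp [ιa, ιb, hE x]
  let ra (χ : DirichletCharacter ℂ (a * b)) : DirichletCharacter ℂ a :=
    MulChar.ofUnitHom (χ.toUnitHom.comp ιa)
  let rb (χ : DirichletCharacter ℂ (a * b)) : DirichletCharacter ℂ b :=
    MulChar.ofUnitHom (χ.toUnitHom.comp ιb)
  have hra (χ) : (ra χ).toUnitHom = χ.toUnitHom.comp ιa := by simp [ra]
  have hrb (χ) : (rb χ).toUnitHom = χ.toUnitHom.comp ιb := by simp [rb]
  have hda (d : ℕ) (hd : d ∣ a) (x : (ZMod (a * b))ˣ)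
      (hx : ZMod.unitsMap (mul_dvd_mul_right hd b) x = 1) :
      ZMod.unitsMap hd (ZMod.unitsMap (Nat.dvd_mul_right a b) x) = 1 ∧
      ZMod.unitsMap (Nat.dvd_mul_left b a) x = 1 := by
    constructor
    · rw [← MonoidHom.comp_apply, ZMod.unitsMap_comp hd (Nat.dvd_mul_right a b),
        ← ZMod.unitsMap_comp (Nat.dvd_mul_right d b) (mul_dvd_mul_right hd b),
        MonoidHom.comp_apply, hx, map_one]
    · rw [← ZMod.unitsMap_comp (Nat.dvd_mul_left b d) (mul_dvd_mul_right hd b),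
        MonoidHom.comp_apply, hx, map_one]
  have hdb (d : ℕ) (hd : d ∣ b) (x : (ZMod (a * b))ˣ)
      (hx : ZMod.unitsMap (mul_dvd_mul_left a hd) x = 1) :
      ZMod.unitsMap (Nat.dvd_mul_right a b) x = 1 ∧
      ZMod.unitsMap hd (ZMod.unitsMap (Nat.dvd_mul_left b a) x) = 1 := by
    constructor
    · rw [← ZMod.unitsMap_comp (Nat.dvd_mul_right a d) (mul_dvd_mul_left a hd),
        MonoidHom.comp_apply, hx, map_one]
    · rw [← MonoidHom.comp_apply, ZMod.unitsMap_comp hd (Nat.dvd_mul_left b a),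
        ← ZMod.unitsMap_comp (Nat.dvd_mul_left d a) (mul_dvd_mul_left a hd),
        MonoidHom.comp_apply, hx, map_one]
  have hpa (χ : DirichletCharacter ℂ (a * b)) (hχ : χ.IsPrimitive) : (ra χ).IsPrimitive := by
    refine isPrimitive_of_forall_le fun d hd hk ↦ ?_
    refine Nat.le_of_mul_le_mul_right (hχ.eq_of_ker_le (mul_dvd_mul_right hd b) fun x hx ↦ ?_)
      (NeZero.pos b)
    obtain ⟨h1, h2⟩ := hda d hd x hx
    have h3 : (ra χ).toUnitHom _ = 1 := hk h1
    rw [MonoidHom.mem_ker, hι x, map_mul, h2, map_one, map_one, mul_one]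
    rwa [hra, MonoidHom.comp_apply] at h3
  have hpb (χ : DirichletCharacter ℂ (a * b)) (hχ : χ.IsPrimitive) : (rb χ).IsPrimitive := by
    refine isPrimitive_of_forall_le fun d hd hk ↦ ?_
    refine Nat.le_of_mul_le_mul_left (hχ.eq_of_ker_le (mul_dvd_mul_left a hd) fun x hx ↦ ?_)
      (NeZero.pos a)
    obtain ⟨h1, h2⟩ := hdb d hd x hx
    have h3 : (rb χ).toUnitHom _ = 1 := hk h2
    rw [MonoidHom.mem_ker, hι x, map_mul, h1, map_one, map_one, one_mul]
    rwa [hrb, MonoidHom.comp_apply] at h3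
  have hta (χ : DirichletCharacter ℂ (a * b)) (hχ : χ ^ p = 1) : ra χ ^ p = 1 := by
    ext x
    have := MulChar.ext_iff.1 hχ (ιa x)
    simpa [MulChar.pow_apply_coe, ra] using this
  have htb (χ : DirichletCharacter ℂ (a * b)) (hχ : χ ^ p = 1) : rb χ ^ p = 1 := by
    ext x
    have := MulChar.ext_iff.1 hχ (ιb x)
    simpa [MulChar.pow_apply_coe, rb] using this
  rw [numPrimitiveTorsion, numPrimitiveTorsion, numPrimitiveTorsion, ← Nat.card_prod]
  refine Nat.card_le_card_of_injective
    (fun χ ↦ (⟨ra χ.1, hpa _ χ.2.1, hta _ χ.2.2⟩, ⟨rb χ.1, hpb _ χ.2.1, htb _ χ.2.2⟩)) ?_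
  intro χ ψ hχψ
  have h1 : ra χ.1 = ra ψ.1 := congrArg (fun x ↦ x.1.1) hχψ
  have h2 : rb χ.1 = rb ψ.1 := congrArg (fun x ↦ x.2.1) hχψ
  refine Subtype.ext ((DirichletCharacter.toUnitHom_inj (ψ := ψ.1) (χ := χ.1)).1 ?_)
  have h3 : χ.1.toUnitHom.comp ιa = ψ.1.toUnitHom.comp ιa := by rw [← hra, ← hra, h1]
  have h4 : χ.1.toUnitHom.comp ιb = ψ.1.toUnitHom.comp ιb := by rw [← hrb, ← hrb, h2]
  refine MonoidHom.ext fun x ↦ ?_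
  rw [hι x, map_mul, map_mul]
  exact congrArg₂ _ (DFunLike.congr_fun h3 _) (DFunLike.congr_fun h4 _)

theorem exists_eq_one_add_of_mem_ker {m d : ℕ} (hd : d ∣ m) {u : (ZMod m)ˣ}
    (hu : ZMod.unitsMap hd u = 1) : ∃ t : ZMod m, (u : ZMod m) = 1 + d * t := by
  have h : (ZMod.castHom hd (ZMod d)) ((u : ZMod m) - 1) = 0 := by
    have := congrArg Units.val hu
    rw [map_sub, map_one, sub_eq_zero]
    simpa [ZMod.unitsMap_val] using this
  obtain ⟨z, hz⟩ := ZMod.intCast_surjective ((u : ZMod m) - 1)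
  rw [← hz, map_intCast, ZMod.intCast_zmod_eq_zero_iff_dvd] at h
  obtain ⟨t, rfl⟩ := h
  exact ⟨t, by rw [← sub_eq_iff_eq_add', ← hz]; push_cast; rfl⟩

theorem numPrimitiveTorsion_eq_zero {p m : ℕ}
    (h : ∀ χ : DirichletCharacter ℂ m, χ ^ p = 1 → ¬ χ.IsPrimitive) :
    numPrimitiveTorsion p m = 0 := by
  have : IsEmpty {χ : DirichletCharacter ℂ m // χ.IsPrimitive ∧ χ ^ p = 1} :=
    ⟨fun χ ↦ h χ.1 χ.2.2 χ.2.1⟩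
  exact Nat.card_of_isEmpty

/-- The kernel of reduction from `q ^ k` to `q ^ (k - 1)` has exponent dividing `q`. A character
with trivial `p`-th power kills it because `p` and `q` are coprime, hence is not primitive. -/
theorem numPrimitiveTorsion_pow_eq_zero {p q k : ℕ} (hp : p.Prime) (hq : q.Prime) (hpq : q ≠ p)
    (hk : 2 ≤ k) : numPrimitiveTorsion p (q ^ k) = 0 := by
  have : NeZero (q ^ k) := ⟨pow_ne_zero _ hq.ne_zero⟩
  refine numPrimitiveTorsion_eq_zero fun χ hχ hprim ↦ ?_
  obtain ⟨k, rfl⟩ : ∃ l, k = l + 2 := ⟨k - 2, by omega⟩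
  have hd : q ^ (k + 1) ∣ q ^ (k + 2) := pow_dvd_pow q (by omega)
  refine absurd (hprim.eq_of_ker_le hd fun u hu ↦ ?_)
    (not_le.2 (Nat.pow_lt_pow_right hq.one_lt (by omega)))
  obtain ⟨t, ht⟩ := exists_eq_one_add_of_mem_ker hd hu
  have h1 : (u : ZMod (q ^ (k + 2))) ^ q = 1 := by
    -- In `u ^ q - 1 = (∑ u ^ i) * (u - 1)` each of the `q` summands is `1` mod `q`, so the sum
    -- supplies the one missing factor `q`.
    have hsum : (q : ZMod (q ^ (k + 2))) ∣ ∑ i ∈ Finset.range q, (u : ZMod (q ^ (k + 2))) ^ i := by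
      have h2 : ∀ i ∈ Finset.range q, (q : ZMod (q ^ (k + 2))) ∣ (u : ZMod (q ^ (k + 2))) ^ i - 1 := by
        intro i _
        refine dvd_trans ?_ (sub_one_dvd_pow_sub_one _ i)
        rw [ht, add_sub_cancel_left]
        push_cast
        exact Dvd.dvd.mul_right (dvd_pow_self _ (by omega)) _
      have h3 := Finset.dvd_sum h2
      rw [Finset.sum_sub_distrib] at h3
      simpa using (dvd_sub_left (by simp)).1 h3
    have h4 : ((q : ZMod (q ^ (k + 2)))) ^ (k + 2) ∣ (u : ZMod (q ^ (k + 2))) ^ q - 1 := by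
      rw [← geom_sum_mul, pow_succ' (q : ZMod (q ^ (k + 2))) (k + 1)]
      refine mul_dvd_mul hsum ?_
      rw [ht, add_sub_cancel_left]
      push_cast
      exact dvd_mul_right _ _
    have h5 : ((q : ZMod (q ^ (k + 2)))) ^ (k + 2) = 0 := by
      rw [← Nat.cast_pow, ZMod.natCast_self]
    rw [h5, zero_dvd_iff] at h4
    exact sub_eq_zero.1 h4
  have h1' : u ^ q = 1 := Units.ext (by simpa using h1)
  have h2 : χ.toUnitHom u ^ q = 1 := by rw [← map_pow, h1', map_one]
  have h3 : χ.toUnitHom u ^ p = 1 := by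
    have := MulChar.ext_iff.1 hχ u
    refine Units.ext ?_
    simpa [MulChar.pow_apply_coe] using this
  have h4 := pow_gcd_eq_one.2 ⟨h2, h3⟩
  rwa [(Nat.coprime_primes hq hp).2 hpq, pow_one] at h4

/-- Each `1 + p ^ (k - 1) * t` is the `p`-th power of `1 + p ^ (k - 2) * t`, so `χ ^ p = 1` forces
`χ` to kill it. The quadratic remainder vanishes because `2 * (k - 2) ≥ k` for `k ≥ 4`, uniformly in
`p`, including `p = 2`. -/
theorem numPrimitiveTorsion_self_pow_eq_zero {p k : ℕ} (hp : p.Prime)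
    (hk : 4 ≤ k) : numPrimitiveTorsion p (p ^ k) = 0 := by
  have : NeZero (p ^ k) := ⟨pow_ne_zero _ hp.ne_zero⟩
  refine numPrimitiveTorsion_eq_zero fun χ hχ hprim ↦ ?_
  obtain ⟨k, rfl⟩ : ∃ l, k = l + 4 := ⟨k - 4, by omega⟩
  have hd : p ^ (k + 3) ∣ p ^ (k + 4) := pow_dvd_pow p (by omega)
  refine absurd (hprim.eq_of_ker_le hd fun u hu ↦ ?_)
    (not_le.2 (Nat.pow_lt_pow_right hp.one_lt (by omega)))
  obtain ⟨t, ht⟩ := exists_eq_one_add_of_mem_ker hd hu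
  have h5 : ((p : ZMod (p ^ (k + 4)))) ^ (k + 4) = 0 := by
    rw [← Nat.cast_pow, ZMod.natCast_self]
  have h1 : (1 + (p : ZMod (p ^ (k + 4))) ^ (k + 2) * t) ^ p = u := by
    obtain ⟨c, hc⟩ := Polynomial.powAddExpansion (1 : ZMod (p ^ (k + 4))) (p ^ (k + 2) * t) p
    rw [hc, ht]
    push_cast
    linear_combination (c * t ^ 2 * p ^ k) * h5
  obtain ⟨v, hv⟩ : IsUnit (1 + (p : ZMod (p ^ (k + 4))) ^ (k + 2) * t) := by
    rw [← isUnit_pow_iff hp.ne_zero, h1]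
    exact u.isUnit
  have h2 : v ^ p = u := Units.ext (by rw [Units.val_pow_eq_pow_val, hv, h1])
  rw [MonoidHom.mem_ker, ← h2, map_pow]
  have := MulChar.ext_iff.1 hχ v
  refine Units.ext ?_
  simpa [MulChar.pow_apply_coe] using this

theorem numPrimitiveTorsion_self_pow_le {p : ℕ} (hp : p.Prime) (k : ℕ) :
    numPrimitiveTorsion p (p ^ k) ≤ p ^ 3 := by
  rcases le_or_gt 4 k with hk | hk
  · rw [numPrimitiveTorsion_self_pow_eq_zero hp hk]
    exact Nat.zero_le _
  · have : NeZero (p ^ k) := ⟨pow_ne_zero _ hp.ne_zero⟩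
    calc numPrimitiveTorsion p (p ^ k) ≤ Nat.card (DirichletCharacter ℂ (p ^ k)) :=
          Nat.card_le_card_of_injective _ Subtype.val_injective
      _ = (p ^ k).totient := DirichletCharacter.card_eq_totient_of_hasEnoughRootsOfUnity ℂ _
      _ ≤ p ^ k := Nat.totient_le _
      _ ≤ p ^ 3 := Nat.pow_le_pow_right hp.pos (by omega)

/-- The character group mod `q` is cyclic of order `q - 1`, so it has at most `p` elements killed by
`p`, and only the trivial one if `p ∤ q - 1`. The trivial character is not primitive. -/
theorem numPrimitiveTorsion_prime_le {p q : ℕ} (hp : p.Prime) (hq : q.Prime) :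
    numPrimitiveTorsion p q ≤ if (q : ZMod p) = 1 then p - 1 else 0 := by
  have : Fact q.Prime := ⟨hq⟩
  have hcard : Nat.card (DirichletCharacter ℂ q) = q - 1 := by
    rw [DirichletCharacter.card_eq_totient_of_hasEnoughRootsOfUnity ℂ q, Nat.totient_prime hq]
  have hne : ∀ χ : DirichletCharacter ℂ q, χ.IsPrimitive → χ ≠ 1 := by
    rintro χ hχ rfl
    rw [DirichletCharacter.isPrimitive_def, DirichletCharacter.conductor_one] at hχ
    exact hq.one_lt.ne hχ
  split_ifs with h
  · obtain ⟨e⟩ := DirichletCharacter.mulEquiv_units ℂ q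
    have : IsCyclic (DirichletCharacter ℂ q) := isCyclic_of_surjective e.symm e.symm.surjective
    classical
    have : Fintype (DirichletCharacter ℂ q) := Fintype.ofFinite _
    have hle := IsCyclic.card_pow_eq_one_le (α := DirichletCharacter ℂ q) hp.pos
    have hsub : (Finset.univ.filter fun χ : DirichletCharacter ℂ q ↦ χ.IsPrimitive ∧ χ ^ p = 1) ⊆
        (Finset.univ.filter fun χ : DirichletCharacter ℂ q ↦ χ ^ p = 1).erase 1 := by
      intro χ hχ
      simp only [Finset.mem_filter, Finset.mem_univ, true_and, Finset.mem_erase] at hχ ⊢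
      exact ⟨hne χ hχ.1, hχ.2⟩
    have h2 := Finset.card_le_card hsub
    rw [Finset.card_erase_of_mem (by simp)] at h2
    rw [numPrimitiveTorsion, Nat.card_eq_fintype_card, Fintype.card_subtype]
    omega
  · refine (numPrimitiveTorsion_eq_zero fun χ hχ hprim ↦ hne χ hprim ?_).le
    have h1 : χ ^ (q - 1) = 1 := by rw [← hcard]; exact pow_card_eq_one'
    have h2 := pow_gcd_eq_one.2 ⟨hχ, h1⟩
    rwa [(Nat.Prime.coprime_iff_not_dvd hp).2, pow_one] at h2
    intro hdvd
    apply h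
    rw [← Nat.cast_one, ZMod.natCast_eq_natCast_iff]
    exact ((Nat.modEq_iff_dvd' hq.one_le).2 hdvd).symm

/-! ### The multiplicative majorant -/

/-- An upper bound for `numPrimitiveTorsion p (q ^ k)`. -/
def torsionWeight (p q k : ℕ) : ℕ :=
  if k = 0 then 1 else if q = p then p ^ 3 else if k = 1 ∧ (q : ZMod p) = 1 then p - 1 else 0

/-- The multiplicative function with values `torsionWeight` at prime powers. -/
def torsionMajorant (p m : ℕ) : ℕ := m.factorization.prod (torsionWeight p)

theorem torsionMajorant_mul (p : ℕ) {a b : ℕ} (h : a.Coprime b) :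
    torsionMajorant p (a * b) = torsionMajorant p a * torsionMajorant p b := by
  rw [torsionMajorant, Nat.factorization_mul_of_coprime h]
  exact Finsupp.prod_add_index_of_disjoint (f1 := a.factorization) (f2 := b.factorization)
    (by simpa using h.disjoint_primeFactors) _

theorem torsionMajorant_one (p : ℕ) : torsionMajorant p 1 = 1 := by
  simp [torsionMajorant]

theorem torsionMajorant_pow (p : ℕ) {q : ℕ} (hq : q.Prime) (k : ℕ) :
    torsionMajorant p (q ^ k) = torsionWeight p q k := by
  rw [torsionMajorant, hq.factorization_pow, Finsupp.prod_single_index]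
  simp [torsionWeight]

theorem numPrimitiveTorsion_le_torsionMajorant {p : ℕ} (hp : p.Prime) (m : ℕ) (hm : m ≠ 0) :
    numPrimitiveTorsion p m ≤ torsionMajorant p m := by
  induction m using Nat.recOnPosPrimePosCoprime with
  | zero => exact absurd rfl hm
  | one =>
    rw [torsionMajorant_one, numPrimitiveTorsion]
    exact Finite.card_le_one_iff_subsingleton.2 inferInstance
  | prime_pow q k hq hk =>
    rw [torsionMajorant_pow p hq, torsionWeight, if_neg hk.ne']
    split_ifs with h1 h2
    · rw [h1]
      exact numPrimitiveTorsion_self_pow_le hp k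
    · rw [h2.1, pow_one]
      have := numPrimitiveTorsion_prime_le hp hq
      rwa [if_pos h2.2] at this
    · rcases eq_or_ne k 1 with rfl | hk1
      · rw [pow_one]
        have := numPrimitiveTorsion_prime_le hp hq
        rwa [if_neg (fun h ↦ h2 ⟨rfl, h⟩)] at this
      · exact (numPrimitiveTorsion_pow_eq_zero hp hq h1 (by omega)).le
  | coprime a b ha hb hab iha ihb =>
    have : NeZero a := ⟨by omega⟩
    have : NeZero b := ⟨by omega⟩
    rw [torsionMajorant_mul p hab]
    exact (numPrimitiveTorsion_mul_le p hab).trans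
      (Nat.mul_le_mul (iha (by omega)) (ihb (by omega)))

/-! ### Primes congruent to 1, from `L`-functions near `s = 1` -/

-- Only upper bounds for `|L(s, χ)|` are needed, hence continuity on `[1, 2]` and not the
-- non-vanishing of `L(1, χ)`.
open scoped LSeries.notation in
theorem exists_norm_LSeries_le {N : ℕ} [NeZero N] {χ : DirichletCharacter ℂ N} (hχ : χ ≠ 1) :
    ∃ C : ℝ, 0 < C ∧ ∀ s : ℝ, 1 < s → s ≤ 2 → ‖LSeries ↗χ s‖ ≤ C := by
  have hcont : Continuous fun s : ℝ ↦ χ.LFunction s :=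
    (DirichletCharacter.differentiable_LFunction hχ).continuous.comp Complex.continuous_ofReal
  obtain ⟨C, hC⟩ := (isCompact_Icc (a := (1 : ℝ)) (b := 2)).exists_bound_of_continuousOn
    hcont.continuousOn
  refine ⟨max C 1, by positivity, fun s hs hs2 ↦ ?_⟩
  rw [← DirichletCharacter.LFunction_eq_LSeries χ (by simpa using hs)]
  exact (hC s ⟨hs.le, hs2⟩).trans (le_max_left _ _)

open scoped LSeries.notation in
theorem exists_norm_LSeries_one_le (N : ℕ) [NeZero N] :
    ∃ C : ℝ, 0 < C ∧ ∀ s : ℝ, 1 < s → s ≤ 2 →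
      ‖LSeries ↗(1 : DirichletCharacter ℂ N) s‖ ≤ C * (s - 1)⁻¹ := by
  have hcont : Continuous fun s : ℝ ↦ DirichletCharacter.LFunctionTrivChar₁ N s :=
    (DirichletCharacter.differentiable_LFunctionTrivChar₁ N).continuous.comp
      Complex.continuous_ofReal
  obtain ⟨C, hC⟩ := (isCompact_Icc (a := (1 : ℝ)) (b := 2)).exists_bound_of_continuousOn
    hcont.continuousOn
  refine ⟨max C 1, by positivity, fun s hs hs2 ↦ ?_⟩
  rw [← DirichletCharacter.LFunction_eq_LSeries _ (by simpa using hs)]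
  have hs' : (s : ℂ) ≠ 1 := by exact_mod_cast hs.ne'
  have h := hC s ⟨hs.le, hs2⟩
  rw [DirichletCharacter.LFunctionTrivChar₁, Function.update_of_ne hs', norm_mul,
    ← Complex.ofReal_one, ← Complex.ofReal_sub, Complex.norm_real, Real.norm_of_nonneg
    (by linarith)] at h
  rw [← div_eq_mul_inv, le_div_iff₀ (by linarith), mul_comm]
  exact h.trans (le_max_left _ _)

theorem re_sub_sq_le_re_neg_log {w : ℂ} (hw : ‖w‖ ≤ 1 / 2) :
    w.re - ‖w‖ ^ 2 ≤ (-Complex.log (1 - w)).re := by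
  have h := Complex.norm_log_one_add_sub_self_le (z := -w) (by rw [norm_neg]; linarith)
  rw [norm_neg, ← sub_eq_add_neg, sub_neg_eq_add] at h
  have h1 : (1 - ‖w‖)⁻¹ ≤ 2 := by
    rw [inv_le_comm₀ (by linarith) (by norm_num)]
    linarith
  have h2 := (Complex.re_le_norm _).trans h
  rw [Complex.add_re] at h2
  rw [Complex.neg_re]
  nlinarith [sq_nonneg ‖w‖]

-- By the Euler product each inner real part is `log |L(s, χ)|`. The trivial character contributes
-- the pole, every other character is bounded above.
open scoped LSeries.notation in
theorem exists_sum_re_neg_log_le (N : ℕ) [NeZero N] :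
    ∃ C : ℝ, ∀ s : ℝ, 1 < s → s ≤ 2 →
      ∑ χ : DirichletCharacter ℂ N,
        (∑' q : Nat.Primes, -Complex.log (1 - χ q * (q : ℂ) ^ (-(s : ℂ)))).re ≤
      Real.log (s - 1)⁻¹ + C := by
  classical
  have key (χ : DirichletCharacter ℂ N) : ∃ C : ℝ, ∀ s : ℝ, 1 < s → s ≤ 2 →
      (∑' q : Nat.Primes, -Complex.log (1 - χ q * (q : ℂ) ^ (-(s : ℂ)))).re ≤
        (if χ = 1 then Real.log (s - 1)⁻¹ else 0) + C := by
    have hlog (s : ℝ) (hs : 1 < s) :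
        (∑' q : Nat.Primes, -Complex.log (1 - χ q * (q : ℂ) ^ (-(s : ℂ)))).re =
          Real.log ‖LSeries ↗χ s‖ := by
      rw [← DirichletCharacter.LSeries_eulerProduct_exp_log χ (by simpa using hs),
        Complex.norm_exp, Real.log_exp]
    have hpos (s : ℝ) (hs : 1 < s) : 0 < ‖LSeries ↗χ s‖ := by
      rw [← DirichletCharacter.LSeries_eulerProduct_exp_log χ (by simpa using hs),
        Complex.norm_exp]
      positivity
    split_ifs with h
    · subst h
      obtain ⟨C, hC, hC'⟩ := exists_norm_LSeries_one_le N
      refine ⟨Real.log C, fun s hs hs2 ↦ ?_⟩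
      have hs0 : 0 < (s - 1)⁻¹ := inv_pos.2 (by linarith)
      rw [hlog s hs, add_comm, ← Real.log_mul hC.ne' hs0.ne']
      exact Real.log_le_log (hpos s hs) (hC' s hs hs2)
    · obtain ⟨C, hC, hC'⟩ := exists_norm_LSeries_le h
      refine ⟨Real.log C, fun s hs hs2 ↦ ?_⟩
      rw [hlog s hs, zero_add]
      exact Real.log_le_log (hpos s hs) (hC' s hs hs2)
  choose C hC using key
  refine ⟨∑ χ, C χ, fun s hs hs2 ↦ ?_⟩
  refine (Finset.sum_le_sum fun χ _ ↦ hC χ s hs hs2).trans ?_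
  rw [Finset.sum_add_distrib, Finset.sum_ite_eq']
  simp

/-- The sum of `q ^ (-s)` over primes `q ≡ 1 mod N` is at most `log (1 / (s - 1)) / φ(N) + O(1)`. -/
theorem exists_sum_primes_rpow_le (N : ℕ) [NeZero N] :
    ∃ C : ℝ, ∀ s : ℝ, 1 < s → s ≤ 2 → ∀ T : Finset Nat.Primes,
      ∑ q ∈ T, (if ((q : ℕ) : ZMod N) = 1 then (N.totient : ℝ) * (q : ℝ) ^ (-s) else 0) ≤
        Real.log (s - 1)⁻¹ + C := by
  obtain ⟨C, hC⟩ := exists_sum_re_neg_log_le N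
  have hsq : Summable fun q : Nat.Primes ↦ (N.totient : ℝ) * (q : ℝ) ^ (-2 : ℝ) :=
    (Nat.Primes.summable_rpow.2 (by norm_num)).mul_left _
  refine ⟨C + ∑' q : Nat.Primes, (N.totient : ℝ) * (q : ℝ) ^ (-2 : ℝ), fun s hs hs2 T ↦ ?_⟩
  have hs' : 1 < (s : ℂ).re := by simpa using hs
  have hsum (χ : DirichletCharacter ℂ N) :=
    DirichletCharacter.summable_neg_log_one_sub_mul_prime_cpow χ hs'
  have hsumre (χ : DirichletCharacter ℂ N) := (Complex.hasSum_re (hsum χ).hasSum).summable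
  have hsumre' := summable_sum fun (χ : DirichletCharacter ℂ N) (_ : χ ∈ Finset.univ) ↦ hsumre χ
  -- Orthogonality: summing `χ q` over all characters isolates `q ≡ 1`. Replacing the logarithms by
  -- their linear terms costs `q ^ (-2)` per character.
  have hterm (q : Nat.Primes) :
      (if ((q : ℕ) : ZMod N) = 1 then (N.totient : ℝ) * (q : ℝ) ^ (-s) else 0) ≤
      ∑ χ : DirichletCharacter ℂ N, (-Complex.log (1 - χ q * (q : ℂ) ^ (-(s : ℂ)))).re +
        (N.totient : ℝ) * (q : ℝ) ^ (-2 : ℝ) := by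
    have hq2 : (2 : ℝ) ≤ q := by exact_mod_cast q.2.two_le
    have hq0 : (0 : ℝ) < q := by linarith
    have hpow : (q : ℂ) ^ (-(s : ℂ)) = (((q : ℝ) ^ (-s) : ℝ) : ℂ) := by
      rw [Complex.ofReal_cpow hq0.le]
      simp
    have hle : (q : ℝ) ^ (-s) ≤ (q : ℝ) ^ (-1 : ℝ) :=
      Real.rpow_le_rpow_of_exponent_le (by linarith) (by linarith)
    have hnn : 0 ≤ (q : ℝ) ^ (-s) := by positivity
    have hnorm (χ : DirichletCharacter ℂ N) : ‖χ q * (q : ℂ) ^ (-(s : ℂ))‖ ≤ (q : ℝ) ^ (-1 : ℝ) := by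
      rw [hpow, norm_mul, Complex.norm_real, Real.norm_of_nonneg hnn]
      exact (mul_le_of_le_one_left hnn (χ.norm_le_one _)).trans hle
    have hhalf : (q : ℝ) ^ (-1 : ℝ) ≤ 1 / 2 := by
      rw [Real.rpow_neg_one, one_div]
      exact inv_anti₀ (by norm_num) hq2
    have hstep (χ : DirichletCharacter ℂ N) :
        (χ q).re * (q : ℝ) ^ (-s) ≤ (-Complex.log (1 - χ q * (q : ℂ) ^ (-(s : ℂ)))).re +
          (q : ℝ) ^ (-2 : ℝ) := by
      have h1 := re_sub_sq_le_re_neg_log ((hnorm χ).trans hhalf)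
      have h2 : ‖χ q * (q : ℂ) ^ (-(s : ℂ))‖ ^ 2 ≤ (q : ℝ) ^ (-2 : ℝ) := by
        refine (pow_le_pow_left₀ (norm_nonneg _) (hnorm χ) 2).trans_eq ?_
        rw [← Real.rpow_natCast, ← Real.rpow_mul hq0.le]
        norm_num
      have h3 : (χ q * (q : ℂ) ^ (-(s : ℂ))).re = (χ q).re * (q : ℝ) ^ (-s) := by
        rw [hpow, Complex.re_mul_ofReal]
      linarith
    have htot := Finset.sum_le_sum fun χ (_ : χ ∈ (Finset.univ : Finset (DirichletCharacter ℂ N))) ↦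
      hstep χ
    rw [Finset.sum_add_distrib, ← Finset.sum_mul, ← Complex.re_sum,
      DirichletCharacter.sum_characters_eq, Finset.sum_const, Finset.card_univ, nsmul_eq_mul,
      ← Nat.card_eq_fintype_card,
      DirichletCharacter.card_eq_totient_of_hasEnoughRootsOfUnity ℂ N] at htot
    refine le_trans (le_of_eq ?_) htot
    split_ifs <;> simp
  have hnn (q : Nat.Primes) : 0 ≤
      (if ((q : ℕ) : ZMod N) = 1 then (N.totient : ℝ) * (q : ℝ) ^ (-s) else 0) := by
    split_ifs <;> positivity
  calc _ ≤ ∑ q ∈ T, (∑ χ : DirichletCharacter ℂ N,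
          (-Complex.log (1 - χ q * (q : ℂ) ^ (-(s : ℂ)))).re +
        (N.totient : ℝ) * (q : ℝ) ^ (-2 : ℝ)) := Finset.sum_le_sum fun q _ ↦ hterm q
    _ ≤ ∑' q : Nat.Primes, (∑ χ : DirichletCharacter ℂ N,
          (-Complex.log (1 - χ q * (q : ℂ) ^ (-(s : ℂ)))).re +
        (N.totient : ℝ) * (q : ℝ) ^ (-2 : ℝ)) :=
      (hsumre'.add hsq).sum_le_tsum T fun q _ ↦ (hnn q).trans (hterm q)
    _ = ∑ χ : DirichletCharacter ℂ N,
        (∑' q : Nat.Primes, -Complex.log (1 - χ q * (q : ℂ) ^ (-(s : ℂ)))).re +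
        ∑' q : Nat.Primes, (N.totient : ℝ) * (q : ℝ) ^ (-2 : ℝ) := by
      rw [hsumre'.tsum_add hsq, Summable.tsum_finsetSum fun χ _ ↦ hsumre χ]
      congr 1
      exact Finset.sum_congr rfl fun χ _ ↦ (Complex.re_tsum (hsum χ)).symm
    _ ≤ _ := by linarith [hC s hs hs2]

/-! ### The Dirichlet series of the majorant -/

theorem torsionWeight_zero (p q : ℕ) : torsionWeight p q 0 = 1 := rfl

theorem torsionWeight_self_le {p : ℕ} (hp : p.Prime) (k : ℕ) : torsionWeight p p k ≤ p ^ 3 := by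
  rw [torsionWeight, if_pos (rfl : p = p)]
  split_ifs
  · exact Nat.one_le_pow _ _ hp.pos
  · exact le_rfl

theorem torsionWeight_of_two_le {p q k : ℕ} (hqp : q ≠ p) (hk : 2 ≤ k) :
    torsionWeight p q k = 0 := by
  rw [torsionWeight, if_neg (by omega), if_neg hqp, if_neg (by omega)]

theorem torsionWeight_one {p q : ℕ} (hqp : q ≠ p) :
    torsionWeight p q 1 = if (q : ZMod p) = 1 then p - 1 else 0 := by
  simp [torsionWeight, hqp]

theorem torsionWeight_le_mul {p : ℕ} (hp : p.Prime) (q : ℕ) {j v : ℕ} (hj : j ≠ 0) (hjv : j ≤ v) :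
    torsionWeight p q v ≤ p ^ 3 * torsionWeight p q (v - j) := by
  rcases eq_or_ne q p with rfl | hqp
  · refine (torsionWeight_self_le hp v).trans (Nat.le_mul_of_pos_right _ ?_)
    rw [torsionWeight, if_pos (rfl : q = q)]
    split_ifs
    · exact one_pos
    · exact pow_pos hp.pos 3
  · rcases le_or_gt 2 v with hv | hv
    · rw [torsionWeight_of_two_le hqp hv]
      exact Nat.zero_le _
    · obtain rfl : v = 1 := by omega
      obtain rfl : j = 1 := by omega
      rw [torsionWeight_one hqp, Nat.sub_self, torsionWeight_zero, mul_one]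
      have : p ≤ p ^ 3 := Nat.le_self_pow (by norm_num) p
      split_ifs <;> omega

/-- A substitute for multiplicativity when `d` and `e` share a prime: only one local factor changes.
It is what permits the convolution with `vonMangoldt` in `sum_torsionMajorant_mul_log_le`. -/
theorem torsionMajorant_mul_le {p : ℕ} (hp : p.Prime) {d e : ℕ} (hd : IsPrimePow d) (he : e ≠ 0) :
    torsionMajorant p (d * e) ≤ p ^ 3 * torsionMajorant p e := by
  obtain ⟨q, j, hq, hj, rfl⟩ := hd
  have hq := hq.nat_prime
  obtain ⟨v, n, hn, rfl⟩ := Nat.exists_eq_pow_mul_and_not_dvd he q hq.ne_one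
  have hc (k : ℕ) : (q ^ k).Coprime n := ((Nat.Prime.coprime_iff_not_dvd hq).2 hn).pow_left k
  rw [← mul_assoc, ← pow_add, torsionMajorant_mul p (hc _), torsionMajorant_mul p (hc _),
    torsionMajorant_pow p hq, torsionMajorant_pow p hq, ← mul_assoc]
  refine Nat.mul_le_mul_right _ ?_
  have := torsionWeight_le_mul hp q hj.ne' (Nat.le_add_right j v)
  rwa [Nat.add_sub_cancel_left] at this

/-- For `q ≠ p` the local factor has only two terms and `1 + x ≤ exp x` applies. At `q = p` the
geometric series `∑ p ^ 3 * 2 ^ (-k)` gives `2 * p ^ 3`. -/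
theorem tsum_torsionWeight_le {p q : ℕ} (hp : p.Prime) (hq : q.Prime) {s : ℝ} (hs : 1 < s) :
    Summable (fun k ↦ (torsionWeight p q k : ℝ) * ((q ^ k : ℕ) : ℝ) ^ (-s)) ∧
    ∑' k, (torsionWeight p q k : ℝ) * ((q ^ k : ℕ) : ℝ) ^ (-s) ≤
      (if q = p then 2 * (p : ℝ) ^ 3 else 1) *
        Real.exp (if (q : ZMod p) = 1 then ((p : ℝ) - 1) * (q : ℝ) ^ (-s) else 0) := by
  have hp1 : (1 : ℝ) ≤ p := by exact_mod_cast hp.one_le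
  have hq2 : (2 : ℝ) ≤ q := by exact_mod_cast hq.two_le
  rcases eq_or_ne q p with rfl | hqp
  · have hle (k : ℕ) : (torsionWeight q q k : ℝ) * ((q ^ k : ℕ) : ℝ) ^ (-s) ≤
        (q : ℝ) ^ 3 * (1 / 2) ^ k := by
      refine mul_le_mul (by exact_mod_cast torsionWeight_self_le hp k) ?_ (by positivity)
        (by positivity)
      have h1 : (1 : ℝ) ≤ ((q ^ k : ℕ) : ℝ) := by
        exact_mod_cast Nat.one_le_pow _ _ hp.pos
      calc ((q ^ k : ℕ) : ℝ) ^ (-s) ≤ ((q ^ k : ℕ) : ℝ) ^ (-1 : ℝ) :=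
            Real.rpow_le_rpow_of_exponent_le h1 (by linarith)
        _ = (1 / (q : ℝ)) ^ k := by rw [Real.rpow_neg_one]; simp
        _ ≤ (1 / 2) ^ k := by gcongr
    have hsum : Summable fun k : ℕ ↦ (q : ℝ) ^ 3 * (1 / 2) ^ k :=
      summable_geometric_two.mul_left _
    have hS : Summable (fun k ↦ (torsionWeight q q k : ℝ) * ((q ^ k : ℕ) : ℝ) ^ (-s)) :=
      Summable.of_nonneg_of_le (fun k ↦ by positivity) hle hsum
    refine ⟨hS, (hS.tsum_le_tsum hle hsum).trans ?_⟩
    have h01 : ¬ ((q : ZMod q) = 1) := by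
      have : Fact q.Prime := ⟨hq⟩
      rw [ZMod.natCast_self]
      exact zero_ne_one
    rw [if_pos rfl, if_neg h01, Real.exp_zero, mul_one, tsum_mul_left, tsum_geometric_two, mul_comm]
  · have hz (k : ℕ) (hk : k ∉ Finset.range 2) :
        (torsionWeight p q k : ℝ) * ((q ^ k : ℕ) : ℝ) ^ (-s) = 0 := by
      rw [torsionWeight_of_two_le hqp (by rwa [Finset.mem_range, not_lt] at hk),
          Nat.cast_zero, zero_mul]
    refine ⟨summable_of_ne_finset_zero hz, ?_⟩
    rw [tsum_eq_sum hz, Finset.sum_range_succ, Finset.sum_range_one, if_neg hqp, one_mul,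
      torsionWeight_zero, torsionWeight_one hqp, pow_zero, pow_one, Nat.cast_one, Real.one_rpow,
      one_mul, add_comm]
    refine le_trans (le_of_eq ?_) (Real.add_one_le_exp _)
    split_ifs <;> simp [Nat.cast_sub hp.one_le]

theorem sum_torsionMajorant_rpow_le_prod {p : ℕ} (hp : p.Prime) {s : ℝ} (hs : 1 < s) (N : ℕ) :
    ∑ m ∈ Finset.Ioc 0 N, (torsionMajorant p m : ℝ) * (m : ℝ) ^ (-s) ≤
      2 * (p : ℝ) ^ 3 * Real.exp (∑ q ∈ (N + 1).primesBelow,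
        if (q : ZMod p) = 1 then ((p : ℝ) - 1) * (q : ℝ) ^ (-s) else 0) := by
  have hp1 : (1 : ℝ) ≤ p := by exact_mod_cast hp.one_le
  let f : ℕ → ℝ := fun m ↦ (torsionMajorant p m : ℝ) * (m : ℝ) ^ (-s)
  have hf0 (m : ℕ) : 0 ≤ f m := by positivity
  have hf1 : f 1 = 1 := by simp [f, torsionMajorant_one]
  have hmul {m n : ℕ} (h : m.Coprime n) : f (m * n) = f m * f n := by
    simp only [f]
    rw [torsionMajorant_mul p h, Nat.cast_mul, Nat.cast_mul,
      Real.mul_rpow (Nat.cast_nonneg _) (Nat.cast_nonneg _)]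
    ring
  have hpow {q : ℕ} (hq : q.Prime) (k : ℕ) :
      f (q ^ k) = (torsionWeight p q k : ℝ) * ((q ^ k : ℕ) : ℝ) ^ (-s) := by
    simp only [f]
    rw [torsionMajorant_pow p hq]
  obtain ⟨h1, h2⟩ := EulerProduct.summable_and_hasSum_smoothNumbers_prod_primesBelow_tsum hf1 hmul
    (fun {q} hq ↦ by
      simp_rw [Real.norm_of_nonneg (hf0 _), hpow hq]
      exact (tsum_torsionWeight_le hp hq hs).1) (N + 1)
  have h3 : ∑ m ∈ Finset.Ioc 0 N, f m ≤ ∏ q ∈ (N + 1).primesBelow, ∑' k : ℕ, f (q ^ k) := by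
    classical
    have h4 := sum_le_hasSum ((Finset.Ioc 0 N).subtype (· ∈ (N + 1).smoothNumbers))
      (fun i _ ↦ hf0 i) h2
    rwa [Finset.sum_subtype_of_mem f fun m hm ↦ ?_] at h4
    rw [Finset.mem_Ioc] at hm
    exact Nat.mem_smoothNumbers_of_lt hm.1 (by omega)
  refine h3.trans ?_
  have h5 : ∏ q ∈ (N + 1).primesBelow, ∑' k : ℕ, f (q ^ k) ≤ ∏ q ∈ (N + 1).primesBelow,
      ((if q = p then 2 * (p : ℝ) ^ 3 else 1) *
        Real.exp (if (q : ZMod p) = 1 then ((p : ℝ) - 1) * (q : ℝ) ^ (-s) else 0)) := by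
    refine Finset.prod_le_prod (fun q _ ↦ tsum_nonneg fun k ↦ hf0 _) fun q hq ↦ ?_
    have hq := Nat.prime_of_mem_primesBelow hq
    simp_rw [hpow hq]
    exact (tsum_torsionWeight_le hp hq hs).2
  refine h5.trans ?_
  rw [Finset.prod_mul_distrib, Real.exp_sum]
  refine mul_le_mul_of_nonneg_right ?_ (Finset.prod_nonneg fun _ _ ↦ (Real.exp_pos _).le)
  rw [Finset.prod_ite_eq']
  have : (1 : ℝ) ≤ (p : ℝ) ^ 3 := one_le_pow₀ hp1
  split_ifs <;> linarith

/-- The weight `p - 1` equals `φ(p)`, so the exponent of the Euler product is exactly one copy of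
`log (1 / (s - 1))`, up to a constant. -/
theorem exists_sum_torsionMajorant_rpow_le {p : ℕ} (hp : p.Prime) :
    ∃ C : ℝ, 0 < C ∧ ∀ s : ℝ, 1 < s → s ≤ 2 → ∀ N : ℕ,
      ∑ m ∈ Finset.Ioc 0 N, (torsionMajorant p m : ℝ) * (m : ℝ) ^ (-s) ≤ C * (s - 1)⁻¹ := by
  have : NeZero p := ⟨hp.ne_zero⟩
  have hp0 : (0 : ℝ) < p := by exact_mod_cast hp.pos
  obtain ⟨C, hC⟩ := exists_sum_primes_rpow_le p
  refine ⟨2 * (p : ℝ) ^ 3 * Real.exp C, by positivity, fun s hs hs2 N ↦ ?_⟩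
  refine (sum_torsionMajorant_rpow_le_prod hp hs N).trans ?_
  rw [mul_assoc _ (Real.exp C)]
  refine mul_le_mul_of_nonneg_left ?_ (by positivity)
  have hs0 : 0 < (s - 1)⁻¹ := inv_pos.2 (by linarith)
  rw [← Real.exp_log hs0, ← Real.exp_add, Real.exp_le_exp, add_comm C]
  have h := hC s hs hs2 ((N + 1).primesBelow.subtype Nat.Prime)
  rw [Nat.totient_prime hp, Nat.cast_sub hp.one_le, Nat.cast_one] at h
  refine le_trans (le_of_eq ?_) h
  exact (Finset.sum_subtype_of_mem
    (fun q : ℕ ↦ if (q : ZMod p) = 1 then ((p : ℝ) - 1) * (q : ℝ) ^ (-s) else 0)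
    fun q hq ↦ Nat.prime_of_mem_primesBelow hq).symm

/-! ### The mean value of the majorant -/

theorem one_lt_log_of_three_le {N : ℕ} (hN : 3 ≤ N) : 1 < Real.log N := by
  rw [Real.lt_log_iff_exp_lt (by positivity)]
  have : (3 : ℝ) ≤ N := by exact_mod_cast hN
  linarith [Real.exp_one_lt_d9]

/-- Rankin's trick with `s = 1 + 1 / log N`: for `m ≤ N` the extra factor `m ^ (-1 / log N)` is at
least `exp (-1)`. -/
theorem exists_sum_torsionMajorant_div_le {p : ℕ} (hp : p.Prime) :
    ∃ C : ℝ, 0 < C ∧ ∀ N : ℕ, 3 ≤ N →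
      ∑ m ∈ Finset.Ioc 0 N, (torsionMajorant p m : ℝ) / m ≤ C * Real.log N := by
  obtain ⟨C, hC0, hC⟩ := exists_sum_torsionMajorant_rpow_le hp
  refine ⟨Real.exp 1 * C, by positivity, fun N hN ↦ ?_⟩
  have hlog := one_lt_log_of_three_le hN
  have h := hC (1 + (Real.log N)⁻¹) (by linarith [inv_pos.2 (zero_lt_one.trans hlog)])
    (by linarith [inv_le_one_of_one_le₀ hlog.le]) N
  rw [add_sub_cancel_left, inv_inv] at h
  rw [mul_assoc]
  refine le_trans ?_ (mul_le_mul_of_nonneg_left h (Real.exp_pos 1).le)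
  rw [Finset.mul_sum]
  refine Finset.sum_le_sum fun m hm ↦ ?_
  rw [Finset.mem_Ioc] at hm
  have hm0 : (0 : ℝ) < m := by exact_mod_cast hm.1
  rw [mul_left_comm, div_eq_mul_inv]
  refine mul_le_mul_of_nonneg_left ?_ (Nat.cast_nonneg _)
  rw [neg_add, Real.rpow_add hm0, Real.rpow_neg_one, mul_left_comm]
  refine le_mul_of_one_le_right (by positivity) ?_
  rw [Real.rpow_def_of_pos hm0, ← Real.exp_add, Real.one_le_exp_iff, mul_neg, ← sub_eq_add_neg,
    sub_nonneg, ← div_eq_mul_inv, div_le_one (by linarith)]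
  exact Real.log_le_log hm0 (by exact_mod_cast hm.2)

/-- `torsionMajorant p` as an arithmetic function. -/
noncomputable def torsionMajorantArith (p : ℕ) : ArithmeticFunction ℝ :=
  ⟨fun m ↦ if m = 0 then 0 else torsionMajorant p m, if_pos rfl⟩

theorem torsionMajorantArith_apply (p : ℕ) {m : ℕ} (hm : m ≠ 0) :
    torsionMajorantArith p m = torsionMajorant p m := if_neg hm

-- Expand `log m` as the sum of `Λ(d)` over `d * e = m` and replace `g(d * e)` by `p ^ 3 * g(e)`.
-- The sum over `d` is then `ψ(N / e)`, which Chebyshev bounds by `(log 4 + 4) * N / e`.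
open ArithmeticFunction in
theorem sum_torsionMajorant_mul_log_le {p : ℕ} (hp : p.Prime) (N : ℕ) :
    ∑ m ∈ Finset.Ioc 0 N, (torsionMajorant p m : ℝ) * Real.log m ≤
      (p : ℝ) ^ 3 * ((Real.log 4 + 4) * N) *
        ∑ m ∈ Finset.Ioc 0 N, (torsionMajorant p m : ℝ) / m := by
  calc ∑ m ∈ Finset.Ioc 0 N, (torsionMajorant p m : ℝ) * Real.log m
      ≤ ∑ m ∈ Finset.Ioc 0 N, (p : ℝ) ^ 3 * (torsionMajorantArith p * vonMangoldt) m := by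
        refine Finset.sum_le_sum fun m hm ↦ ?_
        rw [← vonMangoldt_sum, ArithmeticFunction.mul_apply,
          ← Nat.sum_divisorsAntidiagonal' (f := fun _ d ↦ vonMangoldt d), Finset.mul_sum,
          Finset.mul_sum]
        refine Finset.sum_le_sum fun x hx ↦ ?_
        obtain ⟨hx, hm0⟩ := Nat.mem_divisorsAntidiagonal.1 hx
        have hx1 : x.1 ≠ 0 := by
          rintro h
          exact hm0 (by rw [← hx, h, zero_mul])
        rw [torsionMajorantArith_apply p hx1, ← mul_assoc]
        by_cases hpp : IsPrimePow x.2
        · refine mul_le_mul_of_nonneg_right ?_ vonMangoldt_nonneg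
          rw [← hx, mul_comm]
          exact_mod_cast torsionMajorant_mul_le hp hpp hx1
        · rw [vonMangoldt_eq_zero_iff.2 hpp, mul_zero, mul_zero]
    _ = (p : ℝ) ^ 3 * ∑ m ∈ Finset.Ioc 0 N, torsionMajorantArith p m *
          ∑ d ∈ Finset.Ioc 0 (N / m), vonMangoldt d := by
        rw [← Finset.mul_sum, sum_Ioc_mul_eq_sum_sum]
    _ ≤ (p : ℝ) ^ 3 * ∑ m ∈ Finset.Ioc 0 N,
          ((Real.log 4 + 4) * N) * ((torsionMajorant p m : ℝ) / m) := by
        refine mul_le_mul_of_nonneg_left (Finset.sum_le_sum fun m hm ↦ ?_) (by positivity)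
        rw [Finset.mem_Ioc] at hm
        rw [torsionMajorantArith_apply p hm.1.ne', ← mul_div_assoc, mul_comm _ (torsionMajorant p m : ℝ),
          mul_div_assoc]
        refine mul_le_mul_of_nonneg_left ?_ (Nat.cast_nonneg _)
        have h := Chebyshev.psi_le_const_mul_self (x := (N : ℝ) / m) (by positivity)
        rw [Chebyshev.psi, Nat.floor_div_eq_div] at h
        rwa [mul_div_assoc]
    _ = _ := by rw [← Finset.mul_sum, ← mul_assoc]

/-- Write `log N = log m + log (N / m)`: the first part is `sum_torsionMajorant_mul_log_le`, the
second uses `log (N / m) ≤ N / m` and accounts for the `+ 1` in `D`. Both are `≪ N log N`, and `log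
N` cancels. -/
theorem exists_sum_torsionMajorant_le {p : ℕ} (hp : p.Prime) :
    ∃ C : ℝ, 0 < C ∧ ∀ N : ℕ, 1 ≤ N →
      ∑ m ∈ Finset.Ioc 0 N, (torsionMajorant p m : ℝ) ≤ C * N := by
  obtain ⟨C, hC0, hC⟩ := exists_sum_torsionMajorant_div_le hp
  have hlog4 : 0 < Real.log 4 := Real.log_pos (by norm_num)
  set D : ℝ := (p : ℝ) ^ 3 * (Real.log 4 + 4) + 1 with hD
  have hD0 : 0 < D := by positivity
  have h3 (N : ℕ) (hN : 3 ≤ N) :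
      ∑ m ∈ Finset.Ioc 0 N, (torsionMajorant p m : ℝ) ≤ D * C * N := by
    have hlog := one_lt_log_of_three_le hN
    have hN0 : (0 : ℝ) < N := by positivity
    have h1 : ∑ m ∈ Finset.Ioc 0 N, (torsionMajorant p m : ℝ) * (Real.log N - Real.log m) ≤
        N * ∑ m ∈ Finset.Ioc 0 N, (torsionMajorant p m : ℝ) / m := by
      rw [Finset.mul_sum]
      refine Finset.sum_le_sum fun m hm ↦ ?_
      rw [Finset.mem_Ioc] at hm
      have hm0 : (0 : ℝ) < m := by exact_mod_cast hm.1
      rw [mul_div_left_comm, ← Real.log_div hN0.ne' hm0.ne']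
      exact mul_le_mul_of_nonneg_left (Real.log_le_self (by positivity)) (Nat.cast_nonneg _)
    have h2 := sum_torsionMajorant_mul_log_le hp N
    have h4 := hC N hN
    simp_rw [mul_sub] at h1
    rw [Finset.sum_sub_distrib, ← Finset.sum_mul] at h1
    have h5 : (∑ m ∈ Finset.Ioc 0 N, (torsionMajorant p m : ℝ)) * Real.log N ≤
        D * N * ∑ m ∈ Finset.Ioc 0 N, (torsionMajorant p m : ℝ) / m := by
      rw [hD]
      linarith
    have h6 : D * N * ∑ m ∈ Finset.Ioc 0 N, (torsionMajorant p m : ℝ) / m ≤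
        D * N * (C * Real.log N) := mul_le_mul_of_nonneg_left h4 (by positivity)
    refine le_of_mul_le_mul_right (h5.trans (h6.trans_eq ?_)) (zero_lt_one.trans hlog)
    ring
  -- The factor `3` covers `N < 3`, by comparison with the sum up to `3`.
  refine ⟨3 * (D * C), by positivity, fun N hN ↦ ?_⟩
  have hN1 : (1 : ℝ) ≤ N := by exact_mod_cast hN
  have hDC : 0 < D * C := by positivity
  rcases le_or_gt 3 N with h | h
  · refine (h3 N h).trans ?_
    nlinarith
  · refine le_trans (Finset.sum_le_sum_of_subset_of_nonneg
      (Finset.Ioc_subset_Ioc_right h.le) fun _ _ _ ↦ Nat.cast_nonneg _) ((h3 3 le_rfl).trans ?_)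
    push_cast
    nlinarith

/-! ### A lower bound for Euler's function -/

/-- The `i`-th smallest element is at least `i + 1`, so `∏ q / (q - 1)` is at most the telescoping
product `∏ (i + 1) / i`. -/
theorem prod_le_card_add_one_mul_prod_sub_one (S : Finset ℕ) (hS : ∀ q ∈ S, 2 ≤ q) :
    ∏ q ∈ S, q ≤ (S.card + 1) * ∏ q ∈ S, (q - 1) := by
  induction S using Finset.induction_on_max with
  | empty => simp
  | insert a S ha ih =>
    have haS : a ∉ S := fun h ↦ lt_irrefl _ (ha a h)
    have ih := ih fun q hq ↦ hS q (Finset.mem_insert_of_mem hq)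
    have hcard : S.card + 2 ≤ a := by
      have h1 : S ⊆ Finset.Ico 2 a := fun q hq ↦
        Finset.mem_Ico.2 ⟨hS q (Finset.mem_insert_of_mem hq), ha q hq⟩
      have h2 := Finset.card_le_card h1
      have h3 := hS a (Finset.mem_insert_self a S)
      rw [Nat.card_Ico] at h2
      omega
    rw [Finset.prod_insert haS, Finset.prod_insert haS, Finset.card_insert_of_notMem haS]
    obtain ⟨b, rfl⟩ : ∃ b, a = b + 1 := ⟨a - 1, by omega⟩
    rw [Nat.add_sub_cancel]
    calc (b + 1) * ∏ q ∈ S, q ≤ (b + 1) * ((S.card + 1) * ∏ q ∈ S, (q - 1)) :=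
          Nat.mul_le_mul_left _ ih
      _ = ((b + 1) * (S.card + 1)) * ∏ q ∈ S, (q - 1) := by ring
      _ ≤ ((S.card + 1 + 1) * b) * ∏ q ∈ S, (q - 1) := Nat.mul_le_mul_right _ (by nlinarith)
      _ = _ := by ring

theorem le_card_primeFactors_add_one_mul_totient (m : ℕ) :
    m ≤ (m.primeFactors.card + 1) * m.totient := by
  have h1 := Nat.totient_mul_prod_primeFactors m
  have h2 := prod_le_card_add_one_mul_prod_sub_one m.primeFactors
    fun q hq ↦ (Nat.prime_of_mem_primeFactors hq).two_le
  have h3 : 0 < ∏ q ∈ m.primeFactors, (q - 1) := Finset.prod_pos fun q hq ↦ by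
    have := (Nat.prime_of_mem_primeFactors hq).two_le
    omega
  refine Nat.le_of_mul_le_mul_right ?_ h3
  rw [← h1]
  calc _ ≤ m.totient * ((m.primeFactors.card + 1) * ∏ q ∈ m.primeFactors, (q - 1)) :=
        Nat.mul_le_mul_left _ h2
    _ = _ := by ring

theorem two_pow_card_primeFactors_le {m : ℕ} (hm : m ≠ 0) : 2 ^ m.primeFactors.card ≤ m := by
  refine le_trans ?_ (Nat.le_of_dvd (Nat.pos_of_ne_zero hm) (Nat.prod_primeFactors_dvd m))
  exact Finset.pow_card_le_prod _ _ _ fun q hq ↦ (Nat.prime_of_mem_primeFactors hq).two_le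

/-- With `ω(m)` the number of prime factors, `m / φ(m) ≤ ω(m) + 1 ≤ log m / log 2 + 1`, and `1 ≤ log
m / log 2` yields the constant. -/
theorem inv_totient_le {m : ℕ} (hm : 2 ≤ m) :
    ((m.totient : ℝ))⁻¹ ≤ 2 / Real.log 2 * (Real.log m / m) := by
  have hm0 : (0 : ℝ) < m := by positivity
  have hφ : (0 : ℝ) < m.totient := by exact_mod_cast Nat.totient_pos.2 (by omega)
  have hl2 : 0 < Real.log 2 := Real.log_pos (by norm_num)
  have h1 : (m : ℝ) ≤ ((m.primeFactors.card : ℝ) + 1) * m.totient := by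
    exact_mod_cast le_card_primeFactors_add_one_mul_totient m
  have h2 : m.primeFactors.card * Real.log 2 ≤ Real.log m := by
    rw [← Real.log_pow]
    exact Real.log_le_log (by positivity) (by exact_mod_cast two_pow_card_primeFactors_le (by omega))
  have h3 : Real.log 2 ≤ Real.log m := Real.log_le_log (by norm_num) (by exact_mod_cast hm)
  have h4 : 0 < Real.log m := hl2.trans_le h3
  rw [div_mul_div_comm, inv_le_comm₀ hφ (by positivity), inv_div, div_le_iff₀ (by positivity)]
  calc Real.log 2 * m ≤ Real.log 2 * (((m.primeFactors.card : ℝ) + 1) * m.totient) := by gcongr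
    _ = (m.primeFactors.card * Real.log 2 + Real.log 2) * m.totient := by ring
    _ ≤ (2 * Real.log m) * m.totient := by
      refine mul_le_mul_of_nonneg_right ?_ hφ.le
      linarith
    _ = _ := by ring

/-! ### From single terms to dyadic blocks -/

theorem expectationTerm_nonneg (B : ℝ) (α β : ℕ → ℝ) (d m : ℕ) :
    0 ≤ expectationTerm B α β d m := by
  have : 0 ≤ Real.log (m : ℝ) := Real.log_natCast_nonneg m
  unfold expectationTerm
  positivity

theorem expectationTerm_one (B : ℝ) (α β : ℕ → ℝ) {p : ℕ} (hp : p.Prime) :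
    expectationTerm B α β p 1 = 0 := by
  have h : numEvenPrimitive p 1 = 0 := by
    have : IsEmpty {χ : DirichletCharacter ℂ 1 // χ.IsPrimitive ∧ χ.Even ∧ orderOf χ = p} := by
      refine ⟨fun χ ↦ hp.one_lt.ne ?_⟩
      rw [← χ.2.2.2, DirichletCharacter.level_one χ.1, orderOf_one]
    exact Nat.card_of_isEmpty
  rw [expectationTerm, h, Nat.cast_zero, zero_mul]

theorem exists_expectationTerm_le (B : ℝ) (hB : 0 < B) (α β : ℕ → ℝ) {p : ℕ} (hp : p.Prime)
    {σ τ : ℝ} (hσ : σ = (1 - 2 * α p) * ((p : ℝ) - 1) / 4)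
    (hτ : τ = β p * ((p : ℝ) - 1) / 2) :
    ∃ C : ℝ, 0 < C ∧ ∀ m : ℕ, 2 ≤ m → expectationTerm B α β p m ≤
      C * (torsionMajorant p m * ((m : ℝ) ^ (-σ) * Real.log m ^ τ)) := by
  have hp1 : (1 : ℝ) ≤ p := by exact_mod_cast hp.one_le
  have hl2 : 0 < Real.log 2 := Real.log_pos (by norm_num)
  refine ⟨(B ^ 2 * p * (2 / Real.log 2)) ^ (((p : ℝ) - 1) / 4), by positivity, fun m hm ↦ ?_⟩
  have : NeZero m := ⟨by omega⟩
  have hm0 : (0 : ℝ) < m := by positivity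
  have hlog : 0 < Real.log m := Real.log_pos (by exact_mod_cast hm)
  have hF : (numEvenPrimitive p m : ℝ) ≤ torsionMajorant p m := by
    exact_mod_cast (numEvenPrimitive_le_numPrimitiveTorsion p m).trans
      (numPrimitiveTorsion_le_torsionMajorant hp m (by omega))
  have hbase : B ^ 2 * ((p : ℝ) * (m : ℝ) ^ (2 * α p) /
      ((Nat.totient m : ℝ) * Real.log (m : ℝ) ^ (1 - 2 * β p))) ≤
      (B ^ 2 * p * (2 / Real.log 2)) * ((m : ℝ) ^ (2 * α p - 1) * Real.log m ^ (2 * β p)) := by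
    rw [Real.rpow_sub hlog, Real.rpow_one, Real.rpow_sub hm0, Real.rpow_one]
    calc B ^ 2 * ((p : ℝ) * (m : ℝ) ^ (2 * α p) /
          ((Nat.totient m : ℝ) * (Real.log m / Real.log m ^ (2 * β p))))
        = (B ^ 2 * p * (m : ℝ) ^ (2 * α p) * (Real.log m ^ (2 * β p) / Real.log m)) *
          (Nat.totient m : ℝ)⁻¹ := by
          have : 0 < Real.log m ^ (2 * β p) := by positivity
          field_simp
      _ ≤ (B ^ 2 * p * (m : ℝ) ^ (2 * α p) * (Real.log m ^ (2 * β p) / Real.log m)) *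
          (2 / Real.log 2 * (Real.log m / m)) :=
          mul_le_mul_of_nonneg_left (inv_totient_le hm) (by positivity)
      _ = _ := by field_simp
  have hκ : 0 ≤ ((p : ℝ) - 1) / 4 := by linarith
  rw [expectationTerm, Nat.totient_prime hp, Nat.cast_sub hp.one_le, Nat.cast_one]
  have hpow := Real.rpow_le_rpow (by positivity) hbase hκ
  rw [Real.mul_rpow (x := B ^ 2 * p * (2 / Real.log 2)) (by positivity) (by positivity),
    Real.mul_rpow (x := (m : ℝ) ^ (2 * α p - 1)) (by positivity) (by positivity),
    ← Real.rpow_mul hm0.le, ← Real.rpow_mul hlog.le,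
    show (2 * α p - 1) * (((p : ℝ) - 1) / 4) = -σ by rw [hσ]; ring,
    show 2 * β p * (((p : ℝ) - 1) / 4) = τ by rw [hτ]; ring] at hpow
  calc _ ≤ (torsionMajorant p m : ℝ) * ((B ^ 2 * p * (2 / Real.log 2)) ^ (((p : ℝ) - 1) / 4) *
        ((m : ℝ) ^ (-σ) * Real.log m ^ τ)) :=
        mul_le_mul hF hpow (by positivity) (Nat.cast_nonneg _)
    _ = _ := by ring

/-- Comparable positive reals have comparable real powers. -/
theorem rpow_le_add_mul_rpow {a b x y : ℝ} (ha : 0 < a) (hb : 0 < b) (hy : 0 < y)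
    (hax : a * y ≤ x) (hxb : x ≤ b * y) (τ : ℝ) : x ^ τ ≤ (a ^ τ + b ^ τ) * y ^ τ := by
  have hx : 0 < x := (mul_pos ha hy).trans_le hax
  rw [add_mul, ← Real.mul_rpow ha.le hy.le, ← Real.mul_rpow hb.le hy.le]
  have h1 : 0 < (a * y) ^ τ := by positivity
  have h2 : 0 < (b * y) ^ τ := by positivity
  rcases le_total 0 τ with h | h
  · linarith [Real.rpow_le_rpow hx.le hxb h]
  · linarith [Real.rpow_le_rpow_of_nonpos (mul_pos ha hy) hax h]

theorem exists_sum_dyadic_block_le {p : ℕ} (hp : p.Prime) {σ : ℝ} (hσ : 0 < σ) (τ : ℝ) :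
    ∃ C : ℝ, 0 < C ∧ ∀ k : ℕ, 1 ≤ k → ∑ m ∈ Finset.Ico (2 ^ k) (2 ^ (k + 1)),
      (torsionMajorant p m * ((m : ℝ) ^ (-σ) * Real.log m ^ τ)) ≤
        C * (((2 : ℝ) ^ (1 - σ)) ^ k * (k : ℝ) ^ τ) := by
  obtain ⟨C, hC0, hC⟩ := exists_sum_torsionMajorant_le hp
  have hl2 : 0 < Real.log 2 := Real.log_pos (by norm_num)
  -- On the block `log m` lies between `k log 2` and `2 k log 2`; adding both endpoint powers
  -- handles either sign of `τ`.
  set D : ℝ := Real.log 2 ^ τ + (2 * Real.log 2) ^ τ with hD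
  have hD0 : 0 < D := by positivity
  refine ⟨C * 2 * D, by positivity, fun k hk ↦ ?_⟩
  have hk1 : (1 : ℝ) ≤ k := by exact_mod_cast hk
  have hterm : ∀ m ∈ Finset.Ico (2 ^ k) (2 ^ (k + 1)),
      (torsionMajorant p m * ((m : ℝ) ^ (-σ) * Real.log m ^ τ)) ≤
        torsionMajorant p m * (((2 : ℝ) ^ k) ^ (-σ) * (D * (k : ℝ) ^ τ)) := by
    intro m hm
    rw [Finset.mem_Ico] at hm
    have h1 : (2 : ℝ) ^ k ≤ m := by exact_mod_cast hm.1
    have h2 : (m : ℝ) ≤ 2 ^ (k + 1) := by exact_mod_cast hm.2.le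
    have hm0 : (0 : ℝ) < m := lt_of_lt_of_le (by positivity) h1
    have h3 : k * Real.log 2 ≤ Real.log m := by
      rw [← Real.log_pow]
      exact Real.log_le_log (by positivity) h1
    have h4 : Real.log m ≤ (k + 1) * Real.log 2 := by
      have := Real.log_le_log hm0 h2
      rw [Real.log_pow] at this
      exact_mod_cast this
    refine mul_le_mul_of_nonneg_left (mul_le_mul ?_ ?_ ?_ (by positivity)) (Nat.cast_nonneg _)
    · exact Real.rpow_le_rpow_of_nonpos (by positivity) h1 (by linarith)
    · exact rpow_le_add_mul_rpow hl2 (by positivity) (by linarith) (by linarith) (by nlinarith) τ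
    · have : 0 < Real.log m := lt_of_lt_of_le (by positivity) h3
      positivity
  refine (Finset.sum_le_sum hterm).trans ?_
  rw [← Finset.sum_mul]
  have hsum : ∑ m ∈ Finset.Ico (2 ^ k) (2 ^ (k + 1)), (torsionMajorant p m : ℝ) ≤
      C * (2 * 2 ^ k) := by
    have h1 := hC (2 ^ (k + 1)) Nat.one_le_two_pow
    rw [Nat.cast_pow, Nat.cast_ofNat, pow_succ' (2 : ℝ)] at h1
    refine le_trans (Finset.sum_le_sum_of_subset_of_nonneg ?_ fun _ _ _ ↦ Nat.cast_nonneg _) h1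
    intro m hm
    rw [Finset.mem_Ico] at hm
    rw [Finset.mem_Ioc]
    exact ⟨lt_of_lt_of_le (by positivity) hm.1, hm.2.le⟩
  refine (mul_le_mul_of_nonneg_right hsum (by positivity)).trans_eq ?_
  have h2k : ((2 : ℝ) ^ (1 - σ)) ^ k = 2 ^ k * ((2 : ℝ) ^ k) ^ (-σ) := by
    rw [sub_eq_add_neg, Real.rpow_add (by norm_num), Real.rpow_one, mul_pow,
      ← Real.rpow_mul_natCast (by norm_num), ← Real.rpow_natCast_mul (by norm_num), mul_comm (-σ)]
  rw [h2k]
  ring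

/-- The sum of the orders of magnitude `2 ^ (k (1 - σ)) * k ^ τ` of the first `K` dyadic blocks. -/
noncomputable def dyadicSum (σ τ : ℝ) (K : ℕ) : ℝ :=
  ∑ k ∈ Finset.Icc 1 K, ((2 : ℝ) ^ (1 - σ)) ^ k * (k : ℝ) ^ τ

theorem exists_sum_expectationTerm_le (B : ℝ) (hB : 0 < B) (α β : ℕ → ℝ) {p : ℕ} (hp : p.Prime)
    {σ τ : ℝ} (hσ : σ = (1 - 2 * α p) * ((p : ℝ) - 1) / 4)
    (hτ : τ = β p * ((p : ℝ) - 1) / 2) (hσ0 : 0 < σ) :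
    ∃ C : ℝ, 0 < C ∧ ∀ K : ℕ, ∑ m ∈ Finset.Ico 1 (2 ^ (K + 1)), expectationTerm B α β p m ≤
      C * dyadicSum σ τ K := by
  obtain ⟨C, hC0, hC⟩ := exists_expectationTerm_le B hB α β hp hσ hτ
  obtain ⟨D, hD0, hD⟩ := exists_sum_dyadic_block_le hp hσ0 τ
  refine ⟨C * D, by positivity, fun K ↦ ?_⟩
  induction K with
  -- The block `k = 0` contains only `m = 1`, whose term vanishes.
  | zero => simp [dyadicSum, expectationTerm_one B α β hp]
  | succ K ih =>
    rw [← Finset.sum_Ico_consecutive _ (Nat.one_le_two_pow (n := K + 1))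
      (Nat.pow_le_pow_right (by norm_num) (Nat.le_succ (K + 1))), dyadicSum,
      Finset.sum_Icc_succ_top (by omega), mul_add]
    refine add_le_add ih ?_
    rw [mul_assoc]
    refine le_trans ?_ (mul_le_mul_of_nonneg_left (hD (K + 1) (by omega)) hC0.le)
    rw [Finset.mul_sum]
    refine Finset.sum_le_sum fun m hm ↦ hC m ?_
    rw [Finset.mem_Ico, pow_succ'] at hm
    have : 1 ≤ 2 ^ K := Nat.one_le_two_pow
    omega

theorem exists_expectation_le (B : ℝ) (hB : 0 < B) (α β : ℕ → ℝ) {p : ℕ} (hp : p.Prime)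
    {σ τ : ℝ} (hσ : σ = (1 - 2 * α p) * ((p : ℝ) - 1) / 4)
    (hτ : τ = β p * ((p : ℝ) - 1) / 2) (hσ0 : 0 < σ) :
    ∃ C : ℝ, 0 < C ∧ ∀ X : ℝ, ‖expectation B α β p X‖ ≤ C * dyadicSum σ τ (Nat.log 2 ⌊X⌋₊) := by
  obtain ⟨C, hC0, hC⟩ := exists_sum_expectationTerm_le B hB α β hp hσ hτ hσ0
  refine ⟨C, hC0, fun X ↦ ?_⟩
  rw [expectation, Real.norm_of_nonneg (Finset.sum_nonneg fun m _ ↦ expectationTerm_nonneg ..)]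
  refine le_trans (Finset.sum_le_sum_of_subset_of_nonneg ?_
    fun m _ _ ↦ expectationTerm_nonneg B α β p m) (hC _)
  intro m hm
  rw [Finset.mem_Icc] at hm
  exact Finset.mem_Ico.2 ⟨hm.1, hm.2.trans_lt (Nat.lt_pow_succ_log_self (by norm_num) _)⟩

theorem log_bounds_of_four_le {X : ℝ} (hX : 4 ≤ X) :
    1 ≤ Nat.log 2 ⌊X⌋₊ ∧ (2 : ℝ) ^ (Nat.log 2 ⌊X⌋₊) ≤ X ∧
      1 / 2 * Real.log X ≤ Nat.log 2 ⌊X⌋₊ ∧ (Nat.log 2 ⌊X⌋₊ : ℝ) ≤ 2 * Real.log X := by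
  have hX0 : 0 < X := by linarith
  have hn : 4 ≤ ⌊X⌋₊ := Nat.le_floor (by exact_mod_cast hX)
  have h1 : 1 ≤ Nat.log 2 ⌊X⌋₊ := Nat.log_pos (by norm_num) (by omega)
  have h1' : (1 : ℝ) ≤ Nat.log 2 ⌊X⌋₊ := by exact_mod_cast h1
  have h2 : (2 : ℝ) ^ (Nat.log 2 ⌊X⌋₊) ≤ X := by
    refine le_trans ?_ (Nat.floor_le hX0.le)
    exact_mod_cast Nat.pow_log_le_self 2 (by omega : ⌊X⌋₊ ≠ 0)
  have h3 : X ≤ (2 : ℝ) ^ (Nat.log 2 ⌊X⌋₊ + 1) := by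
    refine (Nat.lt_floor_add_one X).le.trans ?_
    exact_mod_cast Nat.lt_pow_succ_log_self (by norm_num : 1 < 2) ⌊X⌋₊
  have h4 := Real.log_le_log (by positivity) h2
  have h5 := Real.log_le_log hX0 h3
  rw [Real.log_pow] at h4 h5
  push_cast at h5
  have h6 := Real.log_two_gt_d9
  have h7 := Real.log_two_lt_d9
  refine ⟨h1, h2, ?_, ?_⟩ <;> nlinarith

/-! ### Sums over dyadic blocks -/

theorem summable_dyadic {σ τ : ℝ} (h : 1 < σ ∨ (σ = 1 ∧ τ < -1)) :
    Summable fun k : ℕ ↦ ((2 : ℝ) ^ (1 - σ)) ^ k * (k : ℝ) ^ τ := by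
  rcases h with h | ⟨rfl, h⟩
  · have hr : ‖(2 : ℝ) ^ (1 - σ)‖ < 1 := by
      rw [Real.norm_of_nonneg (by positivity)]
      exact Real.rpow_lt_one_of_one_lt_of_neg (by norm_num) (by linarith)
    have hs := summable_pow_mul_geometric_of_norm_lt_one ⌈|τ|⌉₊ hr
    -- Shifting the index makes the base at least `1`, so powers increase with the exponent.
    rw [← summable_nat_add_iff 1] at hs ⊢
    refine Summable.of_nonneg_of_le (fun k ↦ by positivity) (fun k ↦ ?_) hs
    rw [mul_comm]
    refine mul_le_mul_of_nonneg_right ?_ (by positivity)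
    rw [← Real.rpow_natCast]
    refine Real.rpow_le_rpow_of_exponent_le ?_ ((le_abs_self τ).trans (Nat.le_ceil _))
    push_cast
    linarith [Nat.cast_nonneg (α := ℝ) k]
  · simpa using Real.summable_nat_rpow.2 h

theorem dyadicSum_one_neg_one_le (K : ℕ) : dyadicSum 1 (-1) K ≤ 1 + Real.log K := by
  have h := harmonic_le_one_add_log K
  rw [harmonic_eq_sum_Icc] at h
  simpa [dyadicSum, Real.rpow_neg_one] using h

/-- For `τ ≥ 0` every term is at most the last. For `τ ≤ 0`, Bernoulli's inequality with exponent `τ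
+ 1 ≤ 1` gives `(K + 1)^(τ + 1) - K^(τ + 1) ≥ (τ + 1) (K + 1)^τ`, and the sum telescopes. -/
theorem exists_dyadicSum_one_le {τ : ℝ} (hτ : -1 < τ) :
    ∃ C : ℝ, 0 < C ∧ ∀ K : ℕ, dyadicSum 1 τ K ≤ C * (K : ℝ) ^ (τ + 1) := by
  have hτ0 : 0 < τ + 1 := by linarith
  rcases le_total 0 τ with h | h
  · refine ⟨1, one_pos, fun K ↦ ?_⟩
    rw [dyadicSum]
    calc ∑ k ∈ Finset.Icc 1 K, ((2 : ℝ) ^ (1 - 1 : ℝ)) ^ k * (k : ℝ) ^ τ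
        ≤ ∑ k ∈ Finset.Icc 1 K, (K : ℝ) ^ τ := by
          refine Finset.sum_le_sum fun k hk ↦ ?_
          rw [Finset.mem_Icc] at hk
          rw [sub_self, Real.rpow_zero, one_pow, one_mul]
          exact Real.rpow_le_rpow (Nat.cast_nonneg _) (by exact_mod_cast hk.2) h
      _ = 1 * (K : ℝ) ^ (τ + 1) := by
          rw [Finset.sum_const, Nat.card_Icc, Nat.add_sub_cancel, nsmul_eq_mul, one_mul,
            Real.rpow_add_one' (Nat.cast_nonneg _) hτ0.ne', mul_comm]
  · refine ⟨(τ + 1)⁻¹, by positivity, fun K ↦ ?_⟩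
    induction K with
    | zero => simp [dyadicSum, Real.zero_rpow hτ0.ne']
    | succ K ih =>
      rw [dyadicSum, Finset.sum_Icc_succ_top (by omega), ← dyadicSum, sub_self, Real.rpow_zero,
        one_pow, one_mul]
      refine (add_le_add_left ih _).trans ?_
      have hK : (0 : ℝ) < ((K + 1 : ℕ) : ℝ) := by positivity
      set y : ℝ := ((K + 1 : ℕ) : ℝ) with hy
      have hKy : (K : ℝ) = y * (1 + -y⁻¹) := by
        rw [mul_add, mul_neg, mul_inv_cancel₀ hK.ne', hy]
        push_cast
        ring
      have hy1 : y⁻¹ ≤ 1 := inv_le_one_of_one_le₀ (by rw [hy]; simp)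
      have hb := rpow_one_add_le_one_add_mul_self (s := -y⁻¹) (by linarith) hτ0.le (by linarith)
      rw [hKy, Real.mul_rpow hK.le (by linarith)]
      have hyτ : y ^ (τ + 1) = y ^ τ * y := Real.rpow_add_one hK.ne' τ
      have h1 : y ^ (τ + 1) * (1 + -y⁻¹) ^ (τ + 1) ≤ y ^ (τ + 1) - (τ + 1) * y ^ τ := by
        refine (mul_le_mul_of_nonneg_left hb (by positivity)).trans_eq ?_
        rw [hyτ]
        field_simp
        ring
      calc (τ + 1)⁻¹ * (y ^ (τ + 1) * (1 + -y⁻¹) ^ (τ + 1)) + y ^ τ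
          ≤ (τ + 1)⁻¹ * (y ^ (τ + 1) - (τ + 1) * y ^ τ) + y ^ τ := by gcongr
        _ = _ := by field_simp; ring

/-- The ratio `r = 2 ^ (1 - σ)` exceeds `1`, so the last term dominates: going back `j` steps gains
`r ^ (-j)` and loses at most `(j + 1) ^ |τ|`, a summable factor. -/
theorem exists_dyadicSum_le {σ : ℝ} (hσ : σ < 1) (τ : ℝ) :
    ∃ C : ℝ, 0 < C ∧ ∀ K : ℕ, 1 ≤ K →
      dyadicSum σ τ K ≤ C * (((2 : ℝ) ^ (1 - σ)) ^ K * (K : ℝ) ^ τ) := by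
  set r : ℝ := (2 : ℝ) ^ (1 - σ) with hr
  have hr1 : 1 < r := Real.one_lt_rpow (by norm_num) (by linarith)
  have hr0 : 0 < r := by linarith
  have hsum : Summable fun j : ℕ ↦ (r⁻¹) ^ j * ((j : ℝ) + 1) ^ |τ| := by
    have hrn : ‖r⁻¹‖ < 1 := by
      rw [Real.norm_of_nonneg (by positivity)]
      exact inv_lt_one_of_one_lt₀ hr1
    have hs := summable_pow_mul_geometric_of_norm_lt_one ⌈|τ|⌉₊ hrn
    rw [← summable_nat_add_iff 1] at hs
    refine Summable.of_nonneg_of_le (fun k ↦ by positivity) (fun k ↦ ?_) (hs.mul_left r)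
    have : r * (((k + 1 : ℕ) : ℝ) ^ ⌈|τ|⌉₊ * r⁻¹ ^ (k + 1)) =
        r⁻¹ ^ k * ((k : ℝ) + 1) ^ ⌈|τ|⌉₊ := by
      push_cast
      rw [pow_succ]
      field_simp
    rw [this]
    refine mul_le_mul_of_nonneg_left ?_ (by positivity)
    rw [← Real.rpow_natCast]
    exact Real.rpow_le_rpow_of_exponent_le (by linarith [Nat.cast_nonneg (α := ℝ) k])
      (Nat.le_ceil _)
  refine ⟨∑' j : ℕ, (r⁻¹) ^ j * ((j : ℝ) + 1) ^ |τ|, ?_, fun K hK ↦ ?_⟩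
  · refine lt_of_lt_of_le one_pos ?_
    have := hsum.sum_le_tsum {0} fun j _ ↦ by positivity
    simpa using this
  have hterm : ∀ k ∈ Finset.Icc 1 K, r ^ k * (k : ℝ) ^ τ ≤
      (r⁻¹ ^ (K - k) * (((K - k : ℕ) : ℝ) + 1) ^ |τ|) * (r ^ K * (K : ℝ) ^ τ) := by
    intro k hk
    rw [Finset.mem_Icc] at hk
    obtain ⟨j, rfl⟩ := Nat.exists_eq_add_of_le hk.2
    rw [Nat.add_sub_cancel_left]
    have hk0 : (0 : ℝ) < k := by exact_mod_cast hk.1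
    have hk1 : (1 : ℝ) ≤ k := by exact_mod_cast hk.1
    have hj0 : (0 : ℝ) ≤ j := Nat.cast_nonneg j
    have hkj : (0 : ℝ) < ((k + j : ℕ) : ℝ) := by positivity
    -- For negative `τ` this is `k + j ≤ k * (j + 1)`, valid because `k ≥ 1`.
    have hmain : (k : ℝ) ^ τ ≤ ((j : ℝ) + 1) ^ |τ| * ((k + j : ℕ) : ℝ) ^ τ := by
      rcases le_total 0 τ with h | h
      · rw [abs_of_nonneg h]
        refine le_trans (Real.rpow_le_rpow hk0.le (by push_cast; linarith) h)
          (le_mul_of_one_le_left (by positivity) (Real.one_le_rpow (by linarith) h))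
      · rw [abs_of_nonpos h, Real.rpow_neg (by positivity), inv_mul_eq_div,
          ← Real.div_rpow hkj.le (by positivity)]
        refine Real.rpow_le_rpow_of_nonpos (by positivity) ?_ h
        rw [div_le_iff₀ (by positivity)]
        push_cast
        nlinarith
    calc r ^ k * (k : ℝ) ^ τ ≤ r ^ k * (((j : ℝ) + 1) ^ |τ| * ((k + j : ℕ) : ℝ) ^ τ) := by gcongr
      _ = _ := by
        rw [pow_add, inv_pow]
        field_simp
  rw [dyadicSum, ← hr]
  refine (Finset.sum_le_sum hterm).trans ?_
  rw [← Finset.sum_mul]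
  refine mul_le_mul_of_nonneg_right ?_ (by positivity)
  have hinj : Set.InjOn (fun k ↦ K - k) (Finset.Icc 1 K : Set ℕ) := by
    intro a ha b hb hab
    simp only [Finset.coe_Icc, Set.mem_Icc] at ha hb hab
    omega
  rw [← Finset.sum_image (f := fun j : ℕ ↦ (r⁻¹) ^ j * ((j : ℝ) + 1) ^ |τ|) hinj]
  exact hsum.sum_le_tsum _ fun j _ ↦ by positivity

/-! ### Conclusion -/

theorem expectationInfty_lt_top {B : ℝ} {α β : ℕ → ℝ} {p : ℕ} {M : ℝ}
    (h : ∀ K : ℕ, ∑ m ∈ Finset.Ico 1 (2 ^ (K + 1)), expectationTerm B α β p m ≤ M) :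
    expectationInfty B α β p < ⊤ := by
  have hs : Summable fun m : ℕ ↦ expectationTerm B α β p m := by
    -- Summability is shown over `ℕ`; the term at `0` has no meaning here and is simply added to the
    -- bound.
    refine summable_of_sum_range_le (c := expectationTerm B α β p 0 + M)
      (fun m ↦ expectationTerm_nonneg ..) fun n ↦ ?_
    have hsub : Finset.range n ⊆ insert 0 (Finset.Ico 1 (2 ^ (n + 1))) := by
      intro m hm
      have h1 : n < 2 ^ n := Nat.lt_two_pow_self
      have h2 : 2 ^ n ≤ 2 ^ (n + 1) := Nat.pow_le_pow_right (by norm_num) (by omega)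
      rw [Finset.mem_range] at hm
      rw [Finset.mem_insert, Finset.mem_Ico]
      omega
    refine (Finset.sum_le_sum_of_subset_of_nonneg hsub
      fun m _ _ ↦ expectationTerm_nonneg ..).trans ?_
    rw [Finset.sum_insert (by simp)]
    exact add_le_add_right (h n) _
  refine lt_of_le_of_lt (ENNReal.tsum_comp_le_tsum_of_injective PNat.coe_injective
    fun m : ℕ ↦ ENNReal.ofReal (expectationTerm B α β p m)) ?_
  exact hs.tsum_ofReal_lt_top

theorem mainTheorem5 (B : ℝ) (hB : 0 < B) (α β : ℕ → ℝ) (p : ℕ) (hp : p.Prime)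
    (σ τ : ℝ) (hσ : σ = (1 - 2 * α p) * ((p : ℝ) - 1) / 4)
    (hτ : τ = β p * ((p : ℝ) - 1) / 2) :
    ((1 < σ ∨ (σ = 1 ∧ τ < -1)) → expectationInfty B α β p < ⊤) ∧
    ((σ = 1 ∧ τ = -1) →
      Asymptotics.IsBigO Filter.atTop (fun X : ℝ => expectation B α β p X)
        (fun X : ℝ => Real.log (Real.log X))) ∧
    ((σ = 1 ∧ -1 < τ) →
      Asymptotics.IsBigO Filter.atTop (fun X : ℝ => expectation B α β p X)
        (fun X : ℝ => Real.log X ^ (τ + 1))) ∧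
    ((0 < σ ∧ σ < 1) →
      Asymptotics.IsBigO Filter.atTop (fun X : ℝ => expectation B α β p X)
        (fun X : ℝ => X ^ (1 - σ) * Real.log X ^ τ)) := by
  refine ⟨fun h ↦ ?_, fun h ↦ ?_, fun h ↦ ?_, fun h ↦ ?_⟩
  · have hσ0 : 0 < σ := by rcases h with h | h <;> linarith
    obtain ⟨C, hC0, hC⟩ := exists_sum_expectationTerm_le B hB α β hp hσ hτ hσ0
    refine expectationInfty_lt_top fun K ↦ (hC K).trans (mul_le_mul_of_nonneg_left
      ((summable_dyadic h).sum_le_tsum _ fun k _ ↦ by positivity) hC0.le)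
  · obtain ⟨C, hC0, hC⟩ := exists_expectation_le B hB α β hp hσ hτ (by linarith)
    -- With `K ≤ 2 log X`, `1 + log K ≤ 1 + log 2 + log log X ≤ 3 log log X` once `log log X ≥ 1`.
    refine Asymptotics.IsBigO.of_bound (C * 3) ?_
    filter_upwards [Filter.eventually_ge_atTop 4, (Real.tendsto_log_atTop.comp
      Real.tendsto_log_atTop).eventually_ge_atTop 1] with X hX hlog
    obtain ⟨h1, -, -, h4⟩ := log_bounds_of_four_le hX
    have hK : (0 : ℝ) < Nat.log 2 ⌊X⌋₊ := by exact_mod_cast h1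
    have hl : 0 < Real.log X := by linarith
    rw [Function.comp_apply] at hlog
    refine (hC X).trans ?_
    rw [h.1, h.2, mul_assoc, Real.norm_of_nonneg (zero_le_one.trans hlog)]
    refine mul_le_mul_of_nonneg_left ((dyadicSum_one_neg_one_le _).trans ?_) hC0.le
    have h5 := Real.log_le_log hK h4
    rw [Real.log_mul (by norm_num) hl.ne'] at h5
    linarith [Real.log_two_lt_d9]
  · obtain ⟨C, hC0, hC⟩ := exists_expectation_le B hB α β hp hσ hτ (by linarith)
    obtain ⟨D, hD0, hD⟩ := exists_dyadicSum_one_le h.2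
    refine Asymptotics.IsBigO.of_bound (C * (D * ((1 / 2) ^ (τ + 1) + 2 ^ (τ + 1)))) ?_
    filter_upwards [Filter.eventually_ge_atTop 4] with X hX
    obtain ⟨-, -, h3, h4⟩ := log_bounds_of_four_le hX
    have hl : 0 < Real.log X := Real.log_pos (by linarith)
    refine (hC X).trans ?_
    rw [h.1, mul_assoc, mul_assoc, Real.norm_of_nonneg (by positivity)]
    refine mul_le_mul_of_nonneg_left ((hD _).trans (mul_le_mul_of_nonneg_left ?_ hD0.le)) hC0.le
    exact rpow_le_add_mul_rpow (by norm_num) (by norm_num) hl h3 h4 _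
  · obtain ⟨C, hC0, hC⟩ := exists_expectation_le B hB α β hp hσ hτ h.1
    obtain ⟨D, hD0, hD⟩ := exists_dyadicSum_le h.2 τ
    refine Asymptotics.IsBigO.of_bound (C * (D * ((1 / 2) ^ τ + 2 ^ τ))) ?_
    filter_upwards [Filter.eventually_ge_atTop 4] with X hX
    obtain ⟨h1, h2, h3, h4⟩ := log_bounds_of_four_le hX
    have hX0 : 0 < X := by linarith
    have hl : 0 < Real.log X := Real.log_pos (by linarith)
    refine (hC X).trans ?_
    rw [mul_assoc, mul_assoc, Real.norm_of_nonneg (by positivity)]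
    refine mul_le_mul_of_nonneg_left ((hD _ h1).trans (mul_le_mul_of_nonneg_left ?_ hD0.le)) hC0.le
    rw [mul_left_comm]
    refine mul_le_mul ?_ (rpow_le_add_mul_rpow (by norm_num) (by norm_num) hl h3 h4 _)
      (by positivity) (by positivity)
    rw [← Real.rpow_mul_natCast (by norm_num), mul_comm, Real.rpow_natCast_mul (by norm_num)]
    exact Real.rpow_le_rpow (by positivity) h2 (by linarith)
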